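/- Let $d\ge 1$ be an integer, let $X, X_1,X_2,\dots$ be i.i.d. random variables in $\mathbb R^d$ such that $\operatorname{supp} X$ is not contained in any $(d-1)$-dimensional linear subspace of $\mathbb R^d$, and let $S_0:=0$, $S_n:=\sum_{k=1}^n X_k$. Write $\|\cdot\|$ and $\cdot$ for the Euclidean norm and inner product, $\mathbb S^{d-1}:=\{x\in\mathbb R^d:\|x\|=1\}$, $\hat x:=x/\|x\|$ for $x\neq 0$, $\hat 0:=0$, and $\operatorname{hull}A$ for the convex hull of $A\subseteq\mathbb R^d$. Define the (non-random) sets $$\mathcal D:=\Bigl\{u\in\mathbb S^{d-1}:\ \liminf_{n\to\infty}\|\hat S_n-u\|=0\ \text{a.s.}\Bigr\},$$ $$\mathcal D_\pm:=\Bigl\{u\in\mathbb S^{d-1}:\ -\infty=\liminf_{n\to\infty}(S_n\cdot u)<\limsup_{n\to\infty}(S_n\cdot u)=+\infty\ \text{a.s.}\Bigr\}.$$ For $n\ge 0$ let $\mathcal H_n:=\operatorname{hull}\{S_0,S_1,\dots,S_n\}$ and $r_n:=\inf\{\|x\|:x\in\mathbb R^d\setminus\mathcal H_n\}$; let $\mathcal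 H_\infty:=\bigcup_{n\ge 0}\mathcal H_n$ and let $r_\infty:=\lim_{n\to\infty}r_n\in[0,\infty]$, which exists because $r_n$ is non-decreasing in $n$. **Theorem.** Consider the following statements: (i) $0\in\operatorname{int}\operatorname{hull}\mathcal D$; (ii) $\mathbb P(r_\infty=\infty)=1$; (iii) $\mathbb P(\mathcal H_\infty=\mathbb R^d)=1$; (iv) $\mathcal D_\pm=\mathbb S^{d-1}$; (v) $0\in\operatorname{hull}\mathcal D$. Then (i) $\Rightarrow$ (ii) $\Leftrightarrow$ (iii) $\Leftrightarrow$ (iv) $\Rightarrow$ (v). -/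

import Mathlib

open Filter Topology MeasureTheory ProbabilityTheory
open scoped ENNReal

namespace RandomWalkHull

noncomputable section

/-- `x / ‖x‖` for `x ≠ 0`, and `0` for `x = 0`. -/
def hat {d : ℕ} (x : EuclideanSpace ℝ (Fin d)) : EuclideanSpace ℝ (Fin d) :=
  ‖x‖⁻¹ • x

/-- The walk `S_0 = 0`, `S_n = X_1 + ⋯ + X_n`; the increment `X_{k+1}` is `X k` here. -/
def walk {d : ℕ} {Ω : Type*} (X : ℕ → Ω → EuclideanSpace ℝ (Fin d)) (n : ℕ) (ω : Ω) :
    EuclideanSpace ℝ (Fin d) :=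
  ∑ k ∈ Finset.range n, X k ω

/-- The law `ν` is genuinely `d`-dimensional: its support is not contained in any
`(d-1)`-dimensional linear subspace of `ℝ^d`. -/
def GenuinelyDimensional {d : ℕ} (ν : Measure (EuclideanSpace ℝ (Fin d))) : Prop :=
  ∀ W : Submodule ℝ (EuclideanSpace ℝ (Fin d)),
    Module.finrank ℝ W + 1 = d → ¬ (ν.support ⊆ (W : Set (EuclideanSpace ℝ (Fin d))))

/-- The set of almost surely recurrent directions of the walk. -/
def recurrentDirections {d : ℕ} {Ω : Type*} [MeasurableSpace Ω] (P : Measure Ω)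
    (X : ℕ → Ω → EuclideanSpace ℝ (Fin d)) : Set (EuclideanSpace ℝ (Fin d)) :=
  {u | u ∈ Metric.sphere (0 : EuclideanSpace ℝ (Fin d)) 1 ∧
    ∀ᵐ ω ∂P, liminf (fun n => ‖hat (walk X n ω) - u‖) atTop = 0}

/-- The set of directions in which the projection of the walk almost surely oscillates. The
lower and upper limits are taken in the extended reals. -/
def oscillatingDirections {d : ℕ} {Ω : Type*} [MeasurableSpace Ω] (P : Measure Ω)
    (X : ℕ → Ω → EuclideanSpace ℝ (Fin d)) : Set (EuclideanSpace ℝ (Fin d)) :=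
  {u | u ∈ Metric.sphere (0 : EuclideanSpace ℝ (Fin d)) 1 ∧
    ∀ᵐ ω ∂P,
      liminf (fun n => ((inner ℝ (walk X n ω) u : ℝ) : EReal)) atTop = ⊥ ∧
      limsup (fun n => ((inner ℝ (walk X n ω) u : ℝ) : EReal)) atTop = ⊤}

/-- The convex hull of `S_0, …, S_n`. -/
def walkHull {d : ℕ} {Ω : Type*} (X : ℕ → Ω → EuclideanSpace ℝ (Fin d)) (n : ℕ) (ω : Ω) :
    Set (EuclideanSpace ℝ (Fin d)) :=
  convexHull ℝ ((fun k => walk X k ω) '' Set.Iic n)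

/-- The union over `n` of the convex hulls of `S_0, …, S_n`. -/
def walkHullInf {d : ℕ} {Ω : Type*} (X : ℕ → Ω → EuclideanSpace ℝ (Fin d)) (ω : Ω) :
    Set (EuclideanSpace ℝ (Fin d)) :=
  ⋃ n, walkHull X n ω

/-- `r_n`, the infimum of the norms of the points outside the hull of `S_0, …, S_n`, as an
element of `[0, ∞]`. -/
def innerRadius {d : ℕ} {Ω : Type*} (X : ℕ → Ω → EuclideanSpace ℝ (Fin d)) (n : ℕ) (ω : Ω) :
    ℝ≥0∞ :=
  ⨅ x ∈ (walkHull X n ω)ᶜ, ‖x‖ₑ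

theorem innerRadius_mono {d : ℕ} {Ω : Type*} (X : ℕ → Ω → EuclideanSpace ℝ (Fin d)) (ω : Ω) :
    Monotone (fun n => innerRadius X n ω) := by
  intro m n hmn
  refine biInf_mono fun x hx hxm => hx ?_
  exact convexHull_mono (Set.image_mono (Set.Iic_subset_Iic.mpr hmn)) hxm

/-- `r_∞`, the supremum of the nondecreasing sequence `r_n`, that is, its limit. -/
def innerRadiusInf {d : ℕ} {Ω : Type*} (X : ℕ → Ω → EuclideanSpace ℝ (Fin d)) (ω : Ω) :
    ℝ≥0∞ :=
  ⨆ n, innerRadius X n ω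

theorem tendsto_innerRadius {d : ℕ} {Ω : Type*} (X : ℕ → Ω → EuclideanSpace ℝ (Fin d))
    (ω : Ω) :
    Tendsto (fun n => innerRadius X n ω) atTop (𝓝 (innerRadiusInf X ω)) :=
  tendsto_atTop_iSup (innerRadius_mono X ω)

end

end RandomWalkHull

/-!
Everything is expressed through the *barrier cone* of the walk, the random convex cone of the
directions `u` in which the sequence `S_n · u` is bounded above.

For a fixed realisation, the hulls exhaust `ℝ^d` if and only if the inner radii are unbounded (a
ball lies in a polytope with finitely many vertices), and if and only if the barrier cone is trivial
(a proper convex subset of `ℝ^d` lies in a half-space). On the other hand, all directions oscillate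
if and only if each fixed `u ≠ 0` is almost surely outside the barrier cone. The two conditions
differ by the order of "almost surely" and "for all `u`", and the Hewitt–Savage zero–one law allows
the exchange (`ae_barrierCone_subset_zero`): whether the cone meets a given ball has probability
zero or one, so the closure of the cone is almost surely one fixed set, and since a convex set
contains the relative interior of its closure, a nontrivial cone would almost surely contain one
fixed `u ≠ 0`.

If the origin is interior to the convex hull of the recurrent directions, then every `u ≠ 0` makes
an acute angle with a recurrent direction, so `S_n · u > 0` infinitely often. A nondegenerate
one-dimensional random walk with this property is unbounded above
(`ae_notMem_barrierCone_pathSum`): by the zero–one law its upper limit is constant, and if that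
constant were finite, comparison with the shifted walk would force the first step to vanish.

If all directions oscillate, then every half-space `{x | x · v < 0}` is visited infinitely often.
By compactness and the zero–one law the closed half-space contains a recurrent direction, and the
recurrent directions form a compact set, whose convex hull is compact too; separation of the origin
from that hull is therefore impossible.
-/

namespace RandomWalkHull

/-! ### The Hewitt–Savage zero–one law -/

/-- The permutation of `ℕ` exchanging the blocks `[0, N)` and `[N, 2N)`. -/
def blockSwap (N : ℕ) : Equiv.Perm ℕ where
  toFun k := if k < N then k + N else if k < 2 * N then k - N else k
  invFun k := if k < N then k + N else if k < 2 * N then k - N else k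
  left_inv k := by dsimp only; split_ifs <;> omega
  right_inv k := by dsimp only; split_ifs <;> omega

theorem blockSwap_apply_of_lt {N k : ℕ} (h : k < N) : blockSwap N k = k + N := by
  simp [blockSwap, h]

theorem finite_blockSwap_ne (N : ℕ) : {k | blockSwap N k ≠ k}.Finite := by
  refine (Set.finite_lt_nat (2 * N)).subset fun k hk => ?_
  by_contra h
  simp only [Set.mem_ofPred_eq, not_lt] at h
  refine hk ?_
  have h1 : ¬ k < N := by omega
  have h2 : ¬ k < 2 * N := by omega
  simp [blockSwap, h1, h2]

section ZeroOne

variable {E : Type*} [MeasurableSpace E] (ν : Measure E) [IsProbabilityMeasure ν]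

theorem map_comp_perm_infinitePi (σ : Equiv.Perm ℕ) :
    (Measure.infinitePi fun _ : ℕ => ν).map (fun x => x ∘ σ) =
      Measure.infinitePi fun _ : ℕ => ν := by
  have h := Measure.infinitePi_map_piCongrLeft (X := fun _ : ℕ => E) (fun _ : ℕ => ν) σ.symm
  convert h using 2
  funext x i
  obtain ⟨j, rfl⟩ := σ.symm.surjective i
  rw [MeasurableEquiv.coe_piCongrLeft, Equiv.piCongrLeft_apply_apply]
  simp

theorem map_shift_infinitePi :
    (Measure.infinitePi fun _ : ℕ => ν).map (fun x k => x (k + 1)) =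
      Measure.infinitePi fun _ : ℕ => ν := by
  have h : iIndepFun (fun (k : ℕ) (x : ℕ → E) => x k) (Measure.infinitePi fun _ : ℕ => ν) :=
    iIndepFun_infinitePi (X := fun _ x => x) fun _ => measurable_id
  have h1 := (h.precomp (add_left_injective 1)).map_fun_eq_infinitePi_map
    (fun i => measurable_pi_apply _)
  refine h1.trans ?_
  congr 1
  funext i
  exact Measure.infinitePi_map_eval (fun _ : ℕ => ν) (i + 1)

/-- **Hewitt–Savage zero–one law.** A measurable event of an i.i.d. sequence which is invariant
under all finite permutations of the indices has probability `0` or `1`. Approximating the event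
`B` by a cylinder `A` over `[0, N)` and exchanging the blocks `[0, N)` and `[N, 2N)` gives an
independent copy `A'` of `A` approximating `B` equally well, so that `P(B) = P(B)²`. -/
theorem infinitePi_eq_zero_or_one_of_perm_invariant {B : Set (ℕ → E)} (hB : MeasurableSet B)
    (hinv : ∀ σ : Equiv.Perm ℕ, {k | σ k ≠ k}.Finite → (fun x : ℕ → E => x ∘ σ) ⁻¹' B = B) :
    Measure.infinitePi (fun _ : ℕ => ν) B = 0 ∨ Measure.infinitePi (fun _ : ℕ => ν) B = 1 := by
  set μ := Measure.infinitePi (fun _ : ℕ => ν) with hμ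
  have key : ∀ ε : ℝ, 0 < ε → |μ.real B - μ.real B ^ 2| ≤ 4 * ε := by
    intro ε hε
    have hdense : μ.MeasureDense (measurableCylinders fun _ : ℕ => E) :=
      Measure.MeasureDense.of_generateFrom_isSetAlgebra_finite μ isSetAlgebra_measurableCylinders
        generateFrom_measurableCylinders.symm
    obtain ⟨A, hA, hBA⟩ := hdense.approx B hB (measure_ne_top μ B) ε hε
    have hAm : MeasurableSet A := hdense.measurable A hA
    obtain ⟨s, S, hS, rfl⟩ := (mem_measurableCylinders A).1 hA
    set A := cylinder (α := fun _ => E) s S with hAdef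
    set N := s.sup id + 1 with hN
    have hsN : ∀ i ∈ s, i < N := fun i hi =>
      Nat.lt_succ_of_le (Finset.le_sup (f := id) hi)
    set τ := blockSwap N
    have hτm : Measurable (fun x : ℕ → E => x ∘ τ) := by fun_prop
    have hmap : μ.map (fun x => x ∘ τ) = μ := map_comp_perm_infinitePi ν τ
    set A' := (fun x : ℕ → E => x ∘ τ) ⁻¹' A with hA'
    have hA'm : MeasurableSet A' := hτm hAm
    have hμpre : ∀ T : Set (ℕ → E), MeasurableSet T →
        μ.real ((fun x : ℕ → E => x ∘ τ) ⁻¹' T) = μ.real T := by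
      intro T hT
      rw [← map_measureReal_apply hτm hT, hmap]
    have hBA1 : μ.real (symmDiff B A) ≤ ε := by
      rw [measureReal_def]
      exact ENNReal.toReal_le_of_le_ofReal hε.le hBA.le
    have hBA2 : μ.real (symmDiff B A') ≤ ε := by
      have : symmDiff B A' = (fun x : ℕ → E => x ∘ τ) ⁻¹' (symmDiff B A) := by
        rw [Set.preimage_symmDiff, hinv τ (finite_blockSwap_ne N)]
      rw [this, hμpre _ (hB.symmDiff hAm)]
      exact hBA1
    -- After the exchange, `A'` depends on coordinates in `[N, 2N)` only.
    have hindep : μ.real (A ∩ A') = μ.real A * μ.real A := by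
      have hi : iIndepFun (fun (k : ℕ) (x : ℕ → E) => x k) μ :=
        iIndepFun_infinitePi (X := fun _ x => x) fun _ => measurable_id
      have hdisj : Disjoint s (s.image τ) := by
        rw [Finset.disjoint_left]
        intro i hi hi'
        obtain ⟨j, hj, rfl⟩ := Finset.mem_image.1 hi'
        have h1 := hsN _ hi
        rw [blockSwap_apply_of_lt (hsN j hj)] at h1
        omega
      have h2 := hi.indepFun_finset s (s.image τ) hdisj (fun i => measurable_pi_apply i)
      have h3 := h2.comp (φ := id)
        (ψ := fun (y : s.image τ → E) (i : s) => y ⟨τ i, Finset.mem_image_of_mem τ i.2⟩)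
        measurable_id (by fun_prop)
      have h4 := h3.measure_inter_preimage_eq_mul S S hS hS
      have h5 : μ (A ∩ A') = μ A * μ A' := h4
      have h6 : μ.real A' = μ.real A := hμpre A hAm
      rw [← h6]
      nth_rewrite 1 [h6]
      simp only [measureReal_def, h5, ENNReal.toReal_mul]
    have h1 : |μ.real B - μ.real A| ≤ ε :=
      (abs_measureReal_sub_le_measureReal_symmDiff hB.nullMeasurableSet
        hAm.nullMeasurableSet).trans hBA1
    have h2 : |μ.real B - μ.real (A ∩ A')| ≤ 2 * ε := by
      refine (abs_measureReal_sub_le_measureReal_symmDiff hB.nullMeasurableSet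
        (hAm.inter hA'm).nullMeasurableSet).trans ?_
      have hsub : symmDiff B (A ∩ A') ⊆ symmDiff B A ∪ symmDiff B A' := by
        intro x
        simp only [Set.mem_symmDiff, Set.mem_inter_iff, Set.mem_union]
        tauto
      calc μ.real (symmDiff B (A ∩ A')) ≤ μ.real (symmDiff B A ∪ symmDiff B A') :=
            measureReal_mono hsub
        _ ≤ μ.real (symmDiff B A) + μ.real (symmDiff B A') := measureReal_union_le _ _
        _ ≤ 2 * ε := by linarith
    rw [hindep] at h2
    have hA0 : 0 ≤ μ.real A := measureReal_nonneg
    have hA1 : μ.real A ≤ 1 := measureReal_le_one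
    have hB0 : 0 ≤ μ.real B := measureReal_nonneg
    have hB1 : μ.real B ≤ 1 := measureReal_le_one
    have h3 : |μ.real A * μ.real A - μ.real B ^ 2| ≤ 2 * ε := by
      have : μ.real A * μ.real A - μ.real B ^ 2 =
          -((μ.real B - μ.real A) * (μ.real A + μ.real B)) := by ring
      rw [this, abs_neg, abs_mul, abs_of_nonneg (add_nonneg hA0 hB0), mul_comm 2]
      exact mul_le_mul h1 (by linarith) (by linarith) hε.le
    calc |μ.real B - μ.real B ^ 2|
        ≤ |μ.real B - μ.real A * μ.real A| + |μ.real A * μ.real A - μ.real B ^ 2| :=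
          abs_sub_le _ _ _
      _ ≤ 4 * ε := by linarith
  have hzero : μ.real B - μ.real B ^ 2 = 0 := by
    rw [← abs_nonpos_iff]
    refine le_of_forall_pos_le_add fun δ hδ => ?_
    have := key (δ / 4) (by positivity)
    linarith
  have hmul : μ.real B * (1 - μ.real B) = 0 := by linear_combination hzero
  rcases mul_eq_zero.1 hmul with h | h
  · left
    exact (measureReal_eq_zero_iff).1 h
  · right
    have h1 : μ.real B = 1 := by linarith
    rw [measureReal_def, ENNReal.toReal_eq_one_iff] at h1
    exact h1

end ZeroOne

/-- The partial sums `x 0 + ⋯ + x (n - 1)` of a sequence, regarded as a function of the whole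
sequence of steps; the walk is this function evaluated at the sequence of increments. -/
def pathSum {E : Type*} [AddCommMonoid E] (x : ℕ → E) (n : ℕ) : E :=
  ∑ k ∈ Finset.range n, x k

theorem pathSum_comp_perm {E : Type*} [AddCommMonoid E] (x : ℕ → E) {σ : Equiv.Perm ℕ}
    (hσ : {k | σ k ≠ k}.Finite) : ∀ᶠ n in atTop, pathSum (x ∘ σ) n = pathSum x n := by
  obtain ⟨N, hN⟩ := hσ.bddAbove
  have hfix : ∀ k, N < k → σ k = k := by
    intro k hk
    by_contra h
    exact absurd (hN h) (not_le.2 hk)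
  filter_upwards [eventually_gt_atTop N] with n hn
  refine Finset.sum_equiv σ (fun i => ?_) fun i _ => rfl
  simp only [Finset.mem_range]
  constructor
  · intro hi
    by_contra h
    have h1 := σ.injective (hfix (σ i) (by omega))
    omega
  · intro hi
    by_contra h
    rw [hfix i (by omega)] at hi
    omega

/-- The zero–one law for events of an i.i.d. sequence depending only on the partial sums from some
index on. -/
theorem infinitePi_eq_zero_or_one_of_pathSum {E : Type*} [MeasurableSpace E] [AddCommMonoid E]
    (ν : Measure E) [IsProbabilityMeasure ν] {B : Set (ℕ → E)} (hB : MeasurableSet B)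
    (hinv : ∀ x y : ℕ → E, (∀ᶠ n in atTop, pathSum x n = pathSum y n) → x ∈ B → y ∈ B) :
    Measure.infinitePi (fun _ : ℕ => ν) B = 0 ∨ Measure.infinitePi (fun _ : ℕ => ν) B = 1 := by
  refine infinitePi_eq_zero_or_one_of_perm_invariant ν hB fun σ hσ => ?_
  ext x
  have h := pathSum_comp_perm x hσ
  exact ⟨hinv _ _ h, hinv _ _ (h.mono fun n hn => hn.symm)⟩

/-- The same zero–one law for a property of the path: it holds almost surely or fails almost
surely. -/
theorem ae_or_ae_not_of_pathSum {E : Type*} [MeasurableSpace E] [AddCommMonoid E]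
    (ν : Measure E) [IsProbabilityMeasure ν] {p : (ℕ → E) → Prop} (hp : MeasurableSet {x | p x})
    (hinv : ∀ x y : ℕ → E, (∀ᶠ n in atTop, pathSum x n = pathSum y n) → p x → p y) :
    (∀ᵐ x ∂Measure.infinitePi (fun _ : ℕ => ν), p x) ∨
      ∀ᵐ x ∂Measure.infinitePi (fun _ : ℕ => ν), ¬ p x := by
  rcases infinitePi_eq_zero_or_one_of_pathSum ν hp hinv with h | h
  · right
    rw [ae_iff]
    simpa using h
  · left
    rw [← prob_compl_eq_zero_iff hp] at h
    rw [ae_iff]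
    exact h

/-! ### Convex sets in finite dimension -/

section Convexity

variable {E : Type*} [NormedAddCommGroup E] [NormedSpace ℝ E] [FiniteDimensional ℝ E]

/-- The convex hull of a compact set in finite dimension is compact: by Carathéodory's theorem it
is a finite union of continuous images of products of a simplex with powers of the set. -/
theorem isCompact_convexHull_of_isCompact {s : Set E} (hs : IsCompact s) :
    IsCompact (convexHull ℝ s) := by
  have hunion : convexHull ℝ s = ⋃ k ∈ Set.Iic (Module.finrank ℝ E + 1),
      (fun p : (Fin k → ℝ) × (Fin k → E) => ∑ i, p.1 i • p.2 i) ''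
        (stdSimplex ℝ (Fin k) ×ˢ Set.univ.pi fun _ => s) := by
    refine Set.Subset.antisymm (fun x hx => ?_) ?_
    · obtain ⟨ι, _, z, w, hz, hzi, hw, hw1, rfl⟩ := eq_pos_convex_span_of_mem_convexHull hx
      have hcard := hzi.card_le_finrank_succ
      have hle : Fintype.card ι ≤ Module.finrank ℝ E + 1 :=
        hcard.trans (Nat.succ_le_succ (Submodule.finrank_le _))
      let e := (Fintype.equivFin ι).symm
      refine Set.mem_biUnion (Set.mem_Iic.2 hle) ⟨(w ∘ e, z ∘ e), ⟨⟨fun i => (hw _).le, ?_⟩, ?_⟩, ?_⟩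
      · rw [← hw1]
        exact Equiv.sum_comp e w
      · exact fun i _ => hz (Set.mem_range_self _)
      · exact Equiv.sum_comp e fun i => w i • z i
    · refine Set.iUnion₂_subset fun k _ => ?_
      rintro _ ⟨⟨w, z⟩, ⟨hw, hz⟩, rfl⟩
      exact (convex_convexHull ℝ s).sum_mem (fun i _ => hw.1 i) hw.2
        fun i _ => subset_convexHull ℝ s (hz i (Set.mem_univ i))
  rw [hunion]
  refine (Set.finite_Iic _).isCompact_biUnion fun k _ => ?_
  refine IsCompact.image ?_ (by fun_prop)
  exact (isCompact_stdSimplex ℝ (Fin k)).prod (isCompact_univ_pi fun _ => hs)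

/-- A convex set whose closure is the whole finite-dimensional space is the whole space. -/
theorem _root_.Convex.eq_univ_of_closure_eq_univ {C : Set E} (hC : Convex ℝ C)
    (h : closure C = Set.univ) : C = Set.univ := by
  have hspan : affineSpan ℝ C = ⊤ := by
    have hcl : IsClosed (affineSpan ℝ C : Set E) := AffineSubspace.closed_of_finiteDimensional _
    have := closure_minimal (subset_affineSpan ℝ C) hcl
    rw [h, Set.univ_subset_iff] at this
    exact SetLike.coe_injective this
  have hint := hC.interior_nonempty_iff_affineSpan_eq_top.2 hspan
  have := hC.interior_closure_eq_interior_of_nonempty_interior hint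
  rw [h, interior_univ] at this
  exact Set.univ_subset_iff.1 (this ▸ interior_subset)

/-- A convex set containing a nonzero vector has a nonzero point which belongs to every convex set
with the same closure: a point of the interior relative to the linear span. -/
theorem _root_.Convex.exists_ne_zero_forall_mem_of_closure_eq {C : Set E} (hC : Convex ℝ C)
    (h0 : (0 : E) ∈ C) (hne : ∃ c ∈ C, c ≠ 0) :
    ∃ u : E, u ≠ 0 ∧ ∀ C' : Set E, Convex ℝ C' → closure C' = closure C → u ∈ C' := by
  set W := Submodule.span ℝ C with hW
  have hCW : C ⊆ W := Submodule.subset_span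
  have hWcl : IsClosed (W : Set E) := W.closed_of_finiteDimensional
  -- Everything is pulled back to the span `W`, in which `C` has nonempty interior.
  have hpre : ∀ C' : Set E, C' ⊆ W → closure ((↑) ⁻¹' C' : Set W) = (↑) ⁻¹' closure C' := by
    intro C' hC'
    have himage : ((↑) : W → E) '' ((↑) ⁻¹' C') = C' :=
      Set.image_preimage_eq_of_subset fun c hc => ⟨⟨c, hC' hc⟩, rfl⟩
    refine (Topology.IsInducing.subtypeVal.closure_eq_preimage_closure_image _).trans ?_
    exact congrArg (fun s : Set E => ((↑) : W → E) ⁻¹' closure s) himage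
  set D : Set W := (↑) ⁻¹' C with hD
  have hDconv : Convex ℝ D := hC.linear_preimage W.subtype
  have hDspan : affineSpan ℝ D = ⊤ := by
    have h0D : (0 : W) ∈ D := h0
    have hspan : Submodule.span ℝ D = ⊤ := Submodule.span_span_coe_preimage
    rw [← Set.insert_eq_of_mem h0D]
    refine SetLike.coe_injective ((affineSpan_insert_zero (k := ℝ) D).trans ?_)
    rw [hspan]
    rfl
  have hDint : (interior D).Nonempty := hDconv.interior_nonempty_iff_affineSpan_eq_top.2 hDspan
  obtain ⟨c, hc, hc0⟩ := hne
  have : Nontrivial W := ⟨⟨⟨c, hCW hc⟩, 0, fun h => hc0 (congrArg Subtype.val h)⟩⟩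
  obtain ⟨u, hu, hu0⟩ : ∃ u ∈ interior D, u ≠ 0 := by
    by_contra! hall
    have hsub : interior D ⊆ interior {(0 : W)} :=
      interior_maximal (fun u hu => hall u hu) isOpen_interior
    rw [interior_singleton] at hsub
    exact hDint.ne_empty (Set.subset_empty_iff.1 hsub)
  refine ⟨u, fun h => hu0 (Subtype.ext h), fun C' hC' hcl => ?_⟩
  have hC'W : C' ⊆ W :=
    subset_closure.trans (hcl.le.trans (closure_minimal hCW hWcl))
  set D' : Set W := (↑) ⁻¹' C' with hD'
  have hD'conv : Convex ℝ D' := hC'.linear_preimage W.subtype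
  have hDD' : closure D' = closure D := by rw [hpre C' hC'W, hpre C hCW, hcl]
  have hD'int : (interior D').Nonempty := by
    rw [hD'conv.interior_nonempty_iff_affineSpan_eq_top, eq_top_iff, ← hDspan, affineSpan_le]
    exact subset_closure.trans (hDD'.ge.trans (closure_minimal (subset_affineSpan ℝ D')
      (AffineSubspace.closed_of_finiteDimensional _)))
  have hint : interior D' = interior D := by
    rw [← hD'conv.interior_closure_eq_interior_of_nonempty_interior hD'int, hDD',
      hDconv.interior_closure_eq_interior_of_nonempty_interior hDint]
  have hmem : u ∈ D' := interior_subset (hint ▸ hu)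
  exact hmem

end Convexity

/-- A proper convex subset of a finite-dimensional space is contained in a half-space. -/
theorem _root_.Convex.exists_ne_zero_inner_le {E : Type*} [NormedAddCommGroup E]
    [InnerProductSpace ℝ E] [FiniteDimensional ℝ E] {H : Set E} (hH : Convex ℝ H)
    (hne : H.Nonempty) (huniv : H ≠ Set.univ) :
    ∃ u : E, u ≠ 0 ∧ ∃ M : ℝ, ∀ x ∈ H, inner ℝ x u ≤ M := by
  have hcl : closure H ≠ Set.univ := fun h => huniv (hH.eq_univ_of_closure_eq_univ h)
  obtain ⟨y, hy⟩ := (Set.ne_univ_iff_exists_notMem _).1 hcl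
  obtain ⟨f, M, hf, hfy⟩ := geometric_hahn_banach_closed_point hH.closure isClosed_closure hy
  have hfi : ∀ x, inner ℝ x ((InnerProductSpace.toDual ℝ E).symm f) = f x := fun x => by
    rw [real_inner_comm, InnerProductSpace.toDual_symm_apply]
  refine ⟨(InnerProductSpace.toDual ℝ E).symm f, fun h => ?_, M, fun x hx => ?_⟩
  · obtain ⟨x, hx⟩ := hne
    have h1 := hf x (subset_closure hx)
    rw [← hfi, h, inner_zero_right] at h1 hfy
    exact lt_asymm h1 hfy
  · rw [hfi]
    exact (hf x (subset_closure hx)).le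

/-! ### Barrier cones -/

section Paths

variable {E : Type*} [NormedAddCommGroup E] [InnerProductSpace ℝ E]

/-- The barrier cone of a sequence of points: the directions in which it is bounded above. -/
def barrierCone (s : ℕ → E) : Set E :=
  {u | ∃ M : ℝ, ∀ n, inner ℝ (s n) u ≤ M}

theorem convex_barrierCone (s : ℕ → E) : Convex ℝ (barrierCone s) := by
  rintro u ⟨M, hM⟩ v ⟨L, hL⟩ a b ha hb -
  refine ⟨a * M + b * L, fun n => ?_⟩
  rw [inner_add_right, inner_smul_right, inner_smul_right]
  exact add_le_add (mul_le_mul_of_nonneg_left (hM n) ha) (mul_le_mul_of_nonneg_left (hL n) hb)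

theorem zero_mem_barrierCone (s : ℕ → E) : (0 : E) ∈ barrierCone s :=
  ⟨0, fun n => by simp⟩

theorem mem_barrierCone_of_eventually_le {s : ℕ → E} {u : E} {M : ℝ}
    (h : ∀ᶠ n in atTop, inner ℝ (s n) u ≤ M) : u ∈ barrierCone s := by
  have hb : IsBoundedUnder (· ≤ ·) atTop fun n => inner ℝ (s n) u := ⟨M, by simpa using h⟩
  obtain ⟨L, hL⟩ := hb.bddAbove_range
  exact ⟨L, fun n => hL ⟨n, rfl⟩⟩

theorem notMem_barrierCone_iff {s : ℕ → E} {u : E} :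
    u ∉ barrierCone s ↔ ∀ a : ℝ, ∃ᶠ n in atTop, a < inner ℝ (s n) u := by
  constructor
  · intro h a ha
    exact h (mem_barrierCone_of_eventually_le (M := a) (by simpa using ha))
  · rintro h ⟨M, hM⟩
    obtain ⟨n, hn⟩ := (h M).exists
    exact (hM n).not_gt hn

theorem barrierCone_subset_of_eventuallyEq {s t : ℕ → E} (h : ∀ᶠ n in atTop, s n = t n) :
    barrierCone s ⊆ barrierCone t := by
  rintro u ⟨M, hM⟩
  refine mem_barrierCone_of_eventually_le (M := M) ?_
  filter_upwards [h] with n hn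
  exact hn ▸ hM n

end Paths

/-! ### Random walks on the space of step sequences -/

/-- Countably many balls detect the closure of a set in a separable space. -/
theorem closure_subset_closure_of_inter_ball {E : Type*} [PseudoMetricSpace E]
    [TopologicalSpace.SeparableSpace E] [Nonempty E] {C C' : Set E}
    (h : ∀ i k : ℕ, (∃ u ∈ Metric.ball (TopologicalSpace.denseSeq E i) (1 / ((k : ℝ) + 1)), u ∈ C) →
      ∃ u ∈ Metric.ball (TopologicalSpace.denseSeq E i) (1 / ((k : ℝ) + 1)), u ∈ C') :
    closure C ⊆ closure C' := by
  refine closure_minimal (fun a ha => ?_) isClosed_closure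
  refine Metric.mem_closure_iff.2 fun ε hε => ?_
  obtain ⟨k, hk⟩ := exists_nat_one_div_lt (half_pos hε)
  obtain ⟨i, hi⟩ := (TopologicalSpace.denseRange_denseSeq E).exists_dist_lt a
    (ε := 1 / ((k : ℝ) + 1)) Nat.one_div_pos_of_nat
  obtain ⟨u, hu, huC⟩ := h i k ⟨a, hi, ha⟩
  refine ⟨u, huC, ?_⟩
  rw [Metric.mem_ball'] at hu
  linarith [dist_triangle a (TopologicalSpace.denseSeq E i) u]

section PathMeasure

variable {E : Type*} [NormedAddCommGroup E] [InnerProductSpace ℝ E] [FiniteDimensional ℝ E]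
  [MeasurableSpace E] [BorelSpace E]

theorem measurable_pathSum (n : ℕ) : Measurable fun x : ℕ → E => pathSum x n := by
  unfold pathSum
  fun_prop

theorem measurableSet_frequently_pathSum {A : Set E} (hA : MeasurableSet A) :
    MeasurableSet {x : ℕ → E | ∃ᶠ n in atTop, pathSum x n ∈ A} := by
  have : {x : ℕ → E | ∃ᶠ n in atTop, pathSum x n ∈ A} =
      ⋂ a, ⋃ b, ⋃ _ : a ≤ b, (fun x => pathSum x b) ⁻¹' A := by
    ext x
    simp [frequently_atTop]
  rw [this]
  exact .iInter fun a => .iUnion fun b => .iUnion fun _ => measurable_pathSum b hA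

/-- A random walk visits a given set infinitely often with probability zero or one. -/
theorem ae_frequently_or_ae_not_frequently (ν : Measure E) [IsProbabilityMeasure ν] {A : Set E}
    (hA : MeasurableSet A) :
    (∀ᵐ x ∂Measure.infinitePi (fun _ : ℕ => ν), ∃ᶠ n in atTop, pathSum x n ∈ A) ∨
      ∀ᵐ x ∂Measure.infinitePi (fun _ : ℕ => ν), ¬ ∃ᶠ n in atTop, pathSum x n ∈ A := by
  refine ae_or_ae_not_of_pathSum ν (measurableSet_frequently_pathSum hA) fun x y h hx => ?_
  exact (hx.and_eventually h).mono fun n hn => hn.2 ▸ hn.1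

/-- A one-dimensional projection of a random walk which is not degenerate and is positive
infinitely often is unbounded above. Otherwise its upper limit would be an almost surely constant
real number, equal to the upper limit for the walk without its first step, and that step would
have projection zero. -/
theorem ae_notMem_barrierCone_pathSum (ν : Measure E) [IsProbabilityMeasure ν] {v : E}
    (hv : ¬ ∀ᵐ y ∂ν, inner ℝ y v = 0)
    (hpos : ∀ᵐ x ∂Measure.infinitePi (fun _ : ℕ => ν),
      ∃ᶠ n in atTop, 0 < inner ℝ (pathSum x n) v) :
    ∀ᵐ x ∂Measure.infinitePi (fun _ : ℕ => ν), v ∉ barrierCone (pathSum x) := by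
  set μ := Measure.infinitePi (fun _ : ℕ => ν) with hμ
  let Q : ℝ → Prop := fun a => ∀ᵐ x ∂μ, ∃ᶠ n in atTop, a < inner ℝ (pathSum x n) v
  have hQmono : ∀ {a b}, a ≤ b → Q b → Q a := fun {a b} hab hb => by
    filter_upwards [hb] with x hx
    exact hx.mono fun n hn => hab.trans_lt hn
  suffices hall : ∀ a, Q a by
    filter_upwards [ae_all_iff.2 fun m : ℕ => hall m] with x hx
    rintro ⟨M, hM⟩
    obtain ⟨m, hm⟩ := exists_nat_ge M
    obtain ⟨n, hn⟩ := (hx m).exists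
    exact absurd (hM n) (not_le.2 (hm.trans_lt hn))
  by_contra! hbdd
  obtain ⟨b, hb⟩ := hbdd
  refine hv ?_
  have hQbdd : BddAbove {a | Q a} := ⟨b, fun a ha => by
    by_contra hlt
    exact hb (hQmono (not_le.1 hlt).le ha)⟩
  -- `c` is the almost sure value of the upper limit.
  set c := sSup {a | Q a} with hc
  have hlow : ∀ ε > 0, Q (c - ε) := fun ε hε => by
    obtain ⟨a, ha, hca⟩ := exists_lt_of_lt_csSup (s := {a | Q a}) ⟨0, hpos⟩
      (show c - ε < sSup {a | Q a} by linarith)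
    exact hQmono hca.le ha
  have hup : ∀ ε > 0, ∀ᵐ x ∂μ, ¬ ∃ᶠ n in atTop, c + ε < inner ℝ (pathSum x n) v := fun ε hε => by
    have hA : MeasurableSet {y : E | c + ε < inner ℝ y v} :=
      (isOpen_lt continuous_const (by fun_prop)).measurableSet
    refine (ae_frequently_or_ae_not_frequently ν hA).resolve_left fun h => ?_
    have : c + ε ≤ c := le_csSup hQbdd h
    linarith
  have hshift : MeasurePreserving (fun (x : ℕ → E) (k : ℕ) => x (k + 1)) μ μ :=
    ⟨by fun_prop, map_shift_infinitePi ν⟩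
  have hx0 : ∀ᵐ x ∂μ, inner ℝ (x 0) v = 0 := by
    have hlow' := ae_all_iff.2 fun k : ℕ => hlow (1 / ((k : ℝ) + 1)) Nat.one_div_pos_of_nat
    have hup' := ae_all_iff.2 fun k : ℕ => hup (1 / ((k : ℝ) + 1)) Nat.one_div_pos_of_nat
    filter_upwards [hlow', hup', hshift.quasiMeasurePreserving.ae hlow',
      hshift.quasiMeasurePreserving.ae hup'] with x h1 h2 h3 h4
    set y : ℕ → E := fun k => x (k + 1)
    have hstep : ∀ n, inner ℝ (pathSum x (n + 1)) v = inner ℝ (pathSum y n) v + inner ℝ (x 0) v := by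
      intro n
      rw [← inner_add_left]
      congr 1
      exact Finset.sum_range_succ' x n
    -- Both the walk and the shifted walk have upper limit `c`, and they differ by the first step.
    refine le_antisymm ?_ ?_
    · refine le_of_forall_pos_lt_add fun ε hε => ?_
      obtain ⟨k, hk⟩ := exists_nat_one_div_lt (half_pos hε)
      by_contra! hle
      refine h2 k ((tendsto_add_atTop_nat 1).frequently ((h3 k).mono fun n hn => ?_))
      simp only [hstep]
      linarith
    · refine le_of_forall_pos_lt_add fun ε hε => ?_
      obtain ⟨k, hk⟩ := exists_nat_one_div_lt (half_pos hε)
      by_contra! hle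
      have h5 := h1 k
      rw [← map_add_atTop_eq_nat 1, frequently_map] at h5
      refine h4 k (h5.mono fun n hn => ?_)
      rw [hstep] at hn
      linarith
  have hmap : μ.map (fun x => x 0) = ν := Measure.infinitePi_map_eval (fun _ : ℕ => ν) 0
  have hev : Measurable fun x : ℕ → E => x 0 := measurable_pi_apply 0
  rw [← hmap, ae_map_iff hev.aemeasurable
    (isClosed_eq (by fun_prop) continuous_const).measurableSet]
  exact hx0

/-- The event that the barrier cone of the walk meets a given ball is measurable. By compactness of
slightly smaller closed balls it can be expressed through finitely many steps at a time, and then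
through a countable dense set of directions. -/
theorem measurableSet_barrierCone_inter_ball (q : E) (r : ℝ) :
    MeasurableSet {x : ℕ → E | ∃ u ∈ Metric.ball q r, u ∈ barrierCone (pathSum x)} := by
  let d : ℕ → E := TopologicalSpace.denseSeq E
  have heq : {x : ℕ → E | ∃ u ∈ Metric.ball q r, u ∈ barrierCone (pathSum x)} =
      ⋃ M : ℕ, ⋃ k : ℕ, ⋂ N : ℕ, ⋃ i : ℕ, ⋃ _ : dist (d i) q < r - 1 / ((k : ℝ) + 1),
        ⋂ n : ℕ, ⋂ _ : n < N, {x : ℕ → E | inner ℝ (pathSum x n) (d i) < M} := by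
    ext x
    simp only [Set.mem_iUnion, Set.mem_iInter, Set.mem_ofPred_eq, exists_prop, Metric.mem_ball]
    constructor
    · rintro ⟨u, hu, L, hL⟩
      obtain ⟨M, hM⟩ := exists_nat_gt L
      obtain ⟨k, hk⟩ := exists_nat_one_div_lt (sub_pos.2 hu)
      refine ⟨M, k, fun N => ?_⟩
      have hopen : IsOpen ({v : E | dist v q < r - 1 / ((k : ℝ) + 1)} ∩
          ⋂ n ∈ Set.Iio N, {v : E | inner ℝ (pathSum x n) v < M}) :=
        (isOpen_lt (by fun_prop) continuous_const).inter
          ((Set.finite_Iio N).isOpen_biInter fun n _ =>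
            isOpen_lt (by fun_prop) continuous_const)
      obtain ⟨v, hv, i, rfl⟩ := (TopologicalSpace.denseRange_denseSeq E).inter_open_nonempty _ hopen
        ⟨u, by simp only [Set.mem_ofPred_eq]; linarith,
          Set.mem_iInter₂.2 fun n _ => (hL n).trans_lt hM⟩
      exact ⟨i, hv.1, fun n hn => Set.mem_iInter₂.1 hv.2 n hn⟩
    · rintro ⟨M, k, h⟩
      let F : ℕ → Set E := fun N => Metric.closedBall q (r - 1 / ((k : ℝ) + 1)) ∩
        ⋂ n ∈ Set.Iio N, {v : E | inner ℝ (pathSum x n) v ≤ M}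
      have hFcl : ∀ N, IsClosed (F N) := fun N => Metric.isClosed_closedBall.inter
        (isClosed_biInter fun n _ => isClosed_le (by fun_prop) continuous_const)
      obtain ⟨u, hu⟩ := IsCompact.nonempty_iInter_of_sequence_nonempty_isCompact_isClosed F
        (fun N => Set.inter_subset_inter_right _
          (Set.biInter_subset_biInter_left (Set.Iio_subset_Iio N.le_succ)))
        (fun N => by
          obtain ⟨i, hi, hin⟩ := h N
          exact ⟨d i, hi.le, Set.mem_iInter₂.2 fun n hn => (hin n hn).le⟩)
        ((isCompact_closedBall q _).of_isClosed_subset (hFcl 0) Set.inter_subset_left) hFcl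
      rw [Set.mem_iInter] at hu
      refine ⟨u, ?_, M, fun n => ?_⟩
      · have h1 : dist u q ≤ r - 1 / ((k : ℝ) + 1) := (hu 0).1
        have h2 : 0 < 1 / ((k : ℝ) + 1) := Nat.one_div_pos_of_nat
        linarith
      · exact Set.mem_iInter₂.1 (hu (n + 1)).2 n (Nat.lt_succ_self n)
  rw [heq]
  refine .iUnion fun M => .iUnion fun k => .iInter fun N => .iUnion fun i => .iUnion fun _ =>
    .iInter fun n => .iInter fun _ => ?_
  have := measurable_pathSum (E := E) n
  exact measurableSet_lt (by fun_prop) measurable_const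

theorem measurableSet_mem_barrierCone (u : E) :
    MeasurableSet {x : ℕ → E | u ∈ barrierCone (pathSum x)} := by
  have heq : {x : ℕ → E | u ∈ barrierCone (pathSum x)} =
      ⋃ M : ℕ, ⋂ n : ℕ, {x : ℕ → E | inner ℝ (pathSum x n) u ≤ M} := by
    ext x
    simp only [Set.mem_iUnion, Set.mem_iInter, Set.mem_ofPred_eq]
    constructor
    · rintro ⟨L, hL⟩
      obtain ⟨M, hM⟩ := exists_nat_ge L
      exact ⟨M, fun n => (hL n).trans hM⟩
    · rintro ⟨M, hM⟩
      exact ⟨M, hM⟩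
  rw [heq]
  refine .iUnion fun M => .iInter fun n => ?_
  have := measurable_pathSum (E := E) n
  exact measurableSet_le (by fun_prop) measurable_const

/-- If each nonzero direction is almost surely outside the barrier cone of the walk, then almost
surely the barrier cone is trivial. By the zero–one law the closure of the barrier cone is almost
surely a fixed set, so a relative interior point of one realization of the cone lies almost surely
in the cone. -/
theorem ae_barrierCone_subset_zero (ν : Measure E) [IsProbabilityMeasure ν]
    (h : ∀ u : E, u ≠ 0 →
      ∀ᵐ x ∂Measure.infinitePi (fun _ : ℕ => ν), u ∉ barrierCone (pathSum x)) :
    ∀ᵐ x ∂Measure.infinitePi (fun _ : ℕ => ν), barrierCone (pathSum x) ⊆ {0} := by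
  set μ := Measure.infinitePi (fun _ : ℕ => ν) with hμ
  let B : ℕ → ℕ → Set E := fun i k =>
    Metric.ball (TopologicalSpace.denseSeq E i) (1 / ((k : ℝ) + 1))
  let p : ℕ → ℕ → (ℕ → E) → Prop := fun i k x => ∃ u ∈ B i k, u ∈ barrierCone (pathSum x)
  have hp : ∀ᵐ x ∂μ, ∀ i k, p i k x ↔ ∀ᵐ y ∂μ, p i k y := by
    refine ae_all_iff.2 fun i => ae_all_iff.2 fun k => ?_
    have h01 : (∀ᵐ x ∂μ, p i k x) ∨ ∀ᵐ x ∂μ, ¬ p i k x :=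
      ae_or_ae_not_of_pathSum ν (measurableSet_barrierCone_inter_ball _ _)
        fun x y hxy ⟨u, hu, hux⟩ => ⟨u, hu, barrierCone_subset_of_eventuallyEq hxy hux⟩
    rcases h01 with h1 | h1
    · filter_upwards [h1] with x hx
      exact ⟨fun _ => h1, fun _ => hx⟩
    · filter_upwards [h1] with x hx
      refine ⟨fun hx' => absurd hx' hx, fun h2 => ?_⟩
      obtain ⟨y, hy1, hy2⟩ := (h1.and h2).exists
      exact absurd hy2 hy1
  by_contra hnot
  obtain ⟨x, hx, hxp⟩ := ((not_eventually.1 hnot).and_eventually hp).exists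
  obtain ⟨c, hc, hc0⟩ := Set.not_subset.1 hx
  obtain ⟨u, hu0, hu⟩ := (convex_barrierCone (pathSum x)).exists_ne_zero_forall_mem_of_closure_eq
    (zero_mem_barrierCone _) ⟨c, hc, hc0⟩
  obtain ⟨y, hy, hyp⟩ := ((h u hu0).and hp).exists
  refine hy (hu _ (convex_barrierCone _) (Set.Subset.antisymm ?_ ?_))
  · exact closure_subset_closure_of_inter_ball fun i k hik => (hxp i k).2 ((hyp i k).1 hik)
  · exact closure_subset_closure_of_inter_ball fun i k hik => (hyp i k).2 ((hxp i k).1 hik)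

end PathMeasure

/-! ### Upper and lower limits of real sequences -/

theorem limsup_coe_eq_top_iff {f : ℕ → ℝ} :
    limsup (fun n => (f n : EReal)) atTop = ⊤ ↔ ∀ a : ℝ, ∃ᶠ n in atTop, a < f n := by
  constructor
  · intro h a ha
    have hle : limsup (fun n => (f n : EReal)) atTop ≤ (a : EReal) := by
      refine limsup_le_of_le (by isBoundedDefault) ?_
      filter_upwards [ha] with n hn
      exact EReal.coe_le_coe_iff.2 (not_lt.1 hn)
    rw [h] at hle
    exact absurd hle (not_le.2 (EReal.coe_lt_top a))
  · intro h
    refine EReal.eq_top_iff_forall_lt _ |>.2 fun a => ?_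
    refine (EReal.coe_lt_coe_iff.2 (lt_add_one a)).trans_le ?_
    refine le_limsup_of_frequently_le ((h (a + 1)).mono fun n hn => ?_) (by isBoundedDefault)
    exact EReal.coe_le_coe_iff.2 hn.le

theorem liminf_coe_eq_bot_iff {f : ℕ → ℝ} :
    liminf (fun n => (f n : EReal)) atTop = ⊥ ↔ ∀ a : ℝ, ∃ᶠ n in atTop, f n < a := by
  constructor
  · intro h a ha
    have hle : (a : EReal) ≤ liminf (fun n => (f n : EReal)) atTop := by
      refine le_liminf_of_le (by isBoundedDefault) ?_
      filter_upwards [ha] with n hn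
      exact EReal.coe_le_coe_iff.2 (not_lt.1 hn)
    rw [h] at hle
    exact absurd hle (not_le.2 (EReal.bot_lt_coe a))
  · intro h
    refine EReal.eq_bot_iff_forall_lt _ |>.2 fun a => ?_
    refine lt_of_le_of_lt ?_ (EReal.coe_lt_coe_iff.2 (sub_one_lt a))
    refine liminf_le_of_frequently_le ((h (a - 1)).mono fun n hn => ?_) (by isBoundedDefault)
    exact EReal.coe_le_coe_iff.2 hn.le

theorem liminf_eq_zero_iff_of_bounded {f : ℕ → ℝ} {C : ℝ} (h0 : ∀ n, 0 ≤ f n)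
    (hC : ∀ n, f n ≤ C) :
    liminf f atTop = 0 ↔ ∀ k : ℕ, ∃ᶠ n in atTop, f n < 1 / ((k : ℝ) + 1) := by
  have hcob : IsCoboundedUnder (· ≥ ·) atTop f :=
    (isBoundedUnder_of ⟨C, hC⟩ : IsBoundedUnder (· ≤ ·) atTop f).isCoboundedUnder_ge
  have hbdd : IsBoundedUnder (· ≥ ·) atTop f := isBoundedUnder_of ⟨0, h0⟩
  constructor
  · intro h k
    refine frequently_lt_of_liminf_lt hcob ?_
    rw [h]
    exact Nat.one_div_pos_of_nat
  · intro h
    refine le_antisymm ?_ (le_liminf_of_le hcob (Eventually.of_forall h0))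
    refine le_of_forall_pos_le_add fun ε hε => ?_
    obtain ⟨k, hk⟩ := exists_nat_one_div_lt hε
    rw [zero_add]
    exact (liminf_le_of_frequently_le ((h k).mono fun n hn => hn.le) hbdd).trans hk.le

/-! ### Normalised vectors -/

section Hat

variable {d : ℕ}

theorem measurable_hat : Measurable (hat : EuclideanSpace ℝ (Fin d) → _) := by
  unfold hat
  fun_prop

theorem norm_hat_le_one (x : EuclideanSpace ℝ (Fin d)) : ‖hat x‖ ≤ 1 := by
  rw [hat, norm_smul, norm_inv, norm_norm]
  exact inv_mul_le_one

theorem norm_hat_of_ne_zero {x : EuclideanSpace ℝ (Fin d)} (hx : x ≠ 0) : ‖hat x‖ = 1 := by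
  rw [hat, norm_smul, norm_inv, norm_norm]
  exact inv_mul_cancel₀ (norm_ne_zero_iff.2 hx)

theorem inner_hat (x v : EuclideanSpace ℝ (Fin d)) : inner ℝ (hat x) v = ‖x‖⁻¹ * inner ℝ x v := by
  rw [hat, real_inner_smul_left]

end Hat

/-! ### The hulls of a single path -/

section Deterministic

variable {d : ℕ} {Ω : Type*} (X : ℕ → Ω → EuclideanSpace ℝ (Fin d)) (ω : Ω)

theorem monotone_walkHull : Monotone fun n => walkHull X n ω := fun _ _ h =>
  convexHull_mono (Set.image_mono (Set.Iic_subset_Iic.2 h))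

theorem walk_mem_walkHull (n : ℕ) : walk X n ω ∈ walkHull X n ω :=
  subset_convexHull ℝ _ ⟨n, Set.mem_Iic.2 le_rfl, rfl⟩

theorem convex_walkHullInf : Convex ℝ (walkHullInf X ω) :=
  (monotone_walkHull X ω).directed_le.convex_iUnion fun _ => convex_convexHull ℝ _

/-- The inner radius tends to infinity if and only if the hulls exhaust the space: any ball lies in
a polytope, whose finitely many vertices lie in a common hull. -/
theorem innerRadiusInf_eq_top_iff :
    innerRadiusInf X ω = ∞ ↔ walkHullInf X ω = Set.univ := by
  constructor
  · intro h
    refine Set.eq_univ_of_forall fun x => ?_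
    have hlt : ‖x‖ₑ < innerRadiusInf X ω := h ▸ enorm_lt_top
    obtain ⟨n, hn⟩ := lt_iSup_iff.1 hlt
    refine Set.mem_iUnion.2 ⟨n, ?_⟩
    by_contra hx
    exact absurd (iInf₂_le x hx) (not_le.2 hn)
  · intro h
    refine ENNReal.eq_top_of_forall_nnreal_le fun r => ?_
    obtain ⟨t, ht, -⟩ := (convex_closedBall (0 : EuclideanSpace ℝ (Fin d))
      (r : ℝ)).exists_subset_interior_convexHull_finset_of_isCompact
        (isCompact_closedBall _ _) (univ_mem (f := 𝓝ˢ _))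
    have hev : ∀ᶠ n in atTop, ∀ x ∈ t, x ∈ walkHull X n ω := by
      refine (eventually_all_finset t).2 fun x _ => ?_
      obtain ⟨m, hm⟩ := Set.mem_iUnion.1 (h ▸ Set.mem_univ x : x ∈ walkHullInf X ω)
      filter_upwards [eventually_ge_atTop m] with n hn
      exact monotone_walkHull X ω hn hm
    obtain ⟨n, hn⟩ := hev.exists
    refine le_iSup_of_le n (le_iInf₂ fun x hx => ?_)
    have hxr : x ∉ Metric.closedBall (0 : EuclideanSpace ℝ (Fin d)) (r : ℝ) := fun hmem =>
      hx (convexHull_min hn (convex_convexHull ℝ _) (interior_subset (ht hmem)))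
    rw [mem_closedBall_zero_iff, not_le] at hxr
    rw [enorm_eq_nnnorm, ENNReal.coe_le_coe]
    exact hxr.le

theorem walkHullInf_eq_univ_iff :
    walkHullInf X ω = Set.univ ↔ barrierCone (fun n => walk X n ω) ⊆ {0} := by
  constructor
  · rintro h u ⟨M, hM⟩
    have hle : ∀ x, inner ℝ x u ≤ M := fun x => by
      obtain ⟨n, hn⟩ := Set.mem_iUnion.1 (h ▸ Set.mem_univ x : x ∈ walkHullInf X ω)
      refine convexHull_min (t := {y | inner ℝ y u ≤ M}) ?_ ?_ hn
      · rintro _ ⟨k, -, rfl⟩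
        exact hM k
      · simp_rw [real_inner_comm u]
        exact convex_halfSpace_le (innerₛₗ ℝ u).isLinear M
    by_contra hu
    have hu' : inner ℝ u u ≠ 0 := inner_self_ne_zero.2 hu
    have h1 := hle (((M + 1) / inner ℝ u u) • u)
    rw [real_inner_smul_left, div_mul_cancel₀ _ hu'] at h1
    linarith
  · intro h
    by_contra hne
    obtain ⟨u, hu0, M, hM⟩ := (convex_walkHullInf X ω).exists_ne_zero_inner_le
      ⟨walk X 0 ω, Set.mem_iUnion.2 ⟨0, walk_mem_walkHull X ω 0⟩⟩ hne
    exact hu0 (h ⟨M, fun n => hM _ (Set.mem_iUnion.2 ⟨n, walk_mem_walkHull X ω n⟩)⟩)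

end Deterministic

/-! ### Recurrent and oscillating directions -/

section Walk

variable {d : ℕ} {Ω : Type*} [MeasurableSpace Ω] {P : Measure Ω}
  {X : ℕ → Ω → EuclideanSpace ℝ (Fin d)}

theorem mem_recurrentDirections_iff {u : EuclideanSpace ℝ (Fin d)} :
    u ∈ recurrentDirections P X ↔ ‖u‖ = 1 ∧
      ∀ k : ℕ, ∀ᵐ ω ∂P, ∃ᶠ n in atTop, ‖hat (walk X n ω) - u‖ < 1 / ((k : ℝ) + 1) := by
  rw [← ae_all_iff, recurrentDirections, Set.mem_ofPred_eq, mem_sphere_zero_iff_norm]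
  refine and_congr_right fun hu => ?_
  refine eventually_congr (Eventually.of_forall fun ω => ?_)
  refine liminf_eq_zero_iff_of_bounded (C := 2) (fun n => norm_nonneg _) fun n => ?_
  exact (norm_sub_le _ _).trans (by linarith [norm_hat_le_one (walk X n ω)])

theorem mem_oscillatingDirections_iff {u : EuclideanSpace ℝ (Fin d)} :
    u ∈ oscillatingDirections P X ↔ ‖u‖ = 1 ∧
      (∀ᵐ ω ∂P, u ∉ barrierCone fun n => walk X n ω) ∧
        ∀ᵐ ω ∂P, -u ∉ barrierCone fun n => walk X n ω := by
  rw [← eventually_and, oscillatingDirections, Set.mem_ofPred_eq, mem_sphere_zero_iff_norm]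
  refine and_congr_right fun hu => eventually_congr (Eventually.of_forall fun ω => ?_)
  rw [limsup_coe_eq_top_iff, liminf_coe_eq_bot_iff, notMem_barrierCone_iff,
    notMem_barrierCone_iff, and_comm]
  refine and_congr_right fun _ => ⟨fun h a => ?_, fun h a => ?_⟩
  · refine (h (-a)).mono fun n hn => ?_
    rw [inner_neg_right]
    linarith
  · refine (h (-a)).mono fun n hn => ?_
    rw [inner_neg_right] at hn
    linarith

/-- Every direction oscillates if and only if each nonzero direction lies almost surely outside the
barrier cone of the walk. -/
theorem oscillatingDirections_eq_sphere_iff :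
    oscillatingDirections P X = Metric.sphere 0 1 ↔
      ∀ u : EuclideanSpace ℝ (Fin d), u ≠ 0 → ∀ᵐ ω ∂P, u ∉ barrierCone fun n => walk X n ω := by
  constructor
  · intro h u hu
    have hmem : ‖u‖⁻¹ • u ∈ oscillatingDirections P X := by
      rw [h, mem_sphere_zero_iff_norm, norm_smul, norm_inv, norm_norm]
      exact inv_mul_cancel₀ (norm_ne_zero_iff.2 hu)
    filter_upwards [(mem_oscillatingDirections_iff.1 hmem).2.1] with ω hω
    rintro ⟨M, hM⟩
    refine hω ⟨‖u‖⁻¹ * M, fun n => ?_⟩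
    rw [inner_smul_right]
    exact mul_le_mul_of_nonneg_left (hM n) (by positivity)
  · intro h
    refine Set.Subset.antisymm (fun u hu => hu.1) fun u hu => ?_
    rw [mem_sphere_zero_iff_norm] at hu
    have hu0 : u ≠ 0 := by
      rintro rfl
      simp at hu
    exact mem_oscillatingDirections_iff.2 ⟨hu, h u hu0, h (-u) (neg_ne_zero.2 hu0)⟩

theorem isClosed_recurrentDirections : IsClosed (recurrentDirections P X) := by
  refine isClosed_of_closure_subset fun u hu => mem_recurrentDirections_iff.2 ⟨?_, fun k => ?_⟩
  · rw [← mem_sphere_zero_iff_norm]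
    exact closure_minimal (fun w hw => hw.1) Metric.isClosed_sphere hu
  · obtain ⟨w, hw, hwu⟩ := Metric.mem_closure_iff.1 hu (1 / ((k : ℝ) + 1) / 2)
      (half_pos Nat.one_div_pos_of_nat)
    obtain ⟨m, hm⟩ := exists_nat_one_div_lt
      (half_pos (Nat.one_div_pos_of_nat : 0 < 1 / ((k : ℝ) + 1)))
    filter_upwards [(mem_recurrentDirections_iff.1 hw).2 m] with ω hω
    refine hω.mono fun n hn => ?_
    rw [dist_comm, dist_eq_norm] at hwu
    have := norm_sub_le_norm_sub_add_norm_sub (hat (walk X n ω)) w u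
    linarith

theorem isCompact_recurrentDirections : IsCompact (recurrentDirections P X) :=
  (isCompact_sphere 0 1).of_isClosed_subset isClosed_recurrentDirections fun _ hu => hu.1

theorem GenuinelyDimensional.not_ae_inner_eq_zero {ν : Measure (EuclideanSpace ℝ (Fin d))}
    (h : GenuinelyDimensional ν) {u : EuclideanSpace ℝ (Fin d)} (hu : u ≠ 0) :
    ¬ ∀ᵐ y ∂ν, inner ℝ y u = 0 := by
  intro hae
  refine h (Submodule.span ℝ {u})ᗮ ?_ ?_
  · have h1 := Submodule.finrank_add_finrank_orthogonal (Submodule.span ℝ {u})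
    rw [finrank_span_singleton hu, finrank_euclideanSpace_fin] at h1
    omega
  · refine Measure.support_subset_of_isClosed (Submodule.isClosed_orthogonal _) ?_
    filter_upwards [hae] with y hy
    rw [SetLike.mem_coe, Submodule.mem_orthogonal_singleton_iff_inner_left]
    exact hy

theorem measurePreserving_increments (hmeas : ∀ i, Measurable (X i)) (hindep : iIndepFun X P)
    (hident : ∀ i, IdentDistrib (X i) (X 0) P P) :
    MeasurePreserving (fun ω k => X k ω) P (Measure.infinitePi fun _ : ℕ => P.map (X 0)) := by
  refine ⟨measurable_pi_iff.2 hmeas, ?_⟩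
  rw [hindep.map_fun_eq_infinitePi_map hmeas]
  congr 1
  funext i
  exact (hident i).map_eq

section IID

variable [IsProbabilityMeasure P]

theorem ae_frequently_walk_or (hmeas : ∀ i, Measurable (X i)) (hindep : iIndepFun X P)
    (hident : ∀ i, IdentDistrib (X i) (X 0) P P) {A : Set (EuclideanSpace ℝ (Fin d))}
    (hA : MeasurableSet A) :
    (∀ᵐ ω ∂P, ∃ᶠ n in atTop, walk X n ω ∈ A) ∨ ∀ᵐ ω ∂P, ¬ ∃ᶠ n in atTop, walk X n ω ∈ A := by
  have := Measure.isProbabilityMeasure_map (μ := P) (hmeas 0).aemeasurable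
  have hpres := (measurePreserving_increments hmeas hindep hident).quasiMeasurePreserving
  exact (ae_frequently_or_ae_not_frequently (P.map (X 0)) hA).imp hpres.ae hpres.ae

theorem ae_notMem_barrierCone_of_frequently_pos (hmeas : ∀ i, Measurable (X i))
    (hindep : iIndepFun X P) (hident : ∀ i, IdentDistrib (X i) (X 0) P P)
    {u : EuclideanSpace ℝ (Fin d)} (hu : ¬ ∀ᵐ y ∂P.map (X 0), inner ℝ y u = 0)
    (hpos : ∀ᵐ ω ∂P, ∃ᶠ n in atTop, 0 < inner ℝ (walk X n ω) u) :
    ∀ᵐ ω ∂P, u ∉ barrierCone fun n => walk X n ω := by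
  have := Measure.isProbabilityMeasure_map (μ := P) (hmeas 0).aemeasurable
  have hpres := measurePreserving_increments hmeas hindep hident
  refine hpres.quasiMeasurePreserving.ae (ae_notMem_barrierCone_pathSum (P.map (X 0)) hu ?_)
  rw [← hpres.map_eq]
  refine (ae_map_iff hpres.measurable.aemeasurable ?_).2 hpos
  exact measurableSet_frequently_pathSum (A := {y | 0 < inner ℝ y u})
    (isOpen_lt continuous_const (by fun_prop)).measurableSet

theorem ae_barrierCone_walk_subset_zero (hmeas : ∀ i, Measurable (X i))
    (hindep : iIndepFun X P) (hident : ∀ i, IdentDistrib (X i) (X 0) P P)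
    (h : ∀ u : EuclideanSpace ℝ (Fin d), u ≠ 0 →
      ∀ᵐ ω ∂P, u ∉ barrierCone fun n => walk X n ω) :
    ∀ᵐ ω ∂P, barrierCone (fun n => walk X n ω) ⊆ {0} := by
  have := Measure.isProbabilityMeasure_map (μ := P) (hmeas 0).aemeasurable
  have hpres := measurePreserving_increments hmeas hindep hident
  refine hpres.quasiMeasurePreserving.ae
    (ae_barrierCone_subset_zero (P.map (X 0)) fun u hu => ?_)
  rw [← hpres.map_eq]
  exact (ae_map_iff hpres.measurable.aemeasurable (measurableSet_mem_barrierCone u).compl).2 (h u hu)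

/-- If the walk enters an open half-space through the origin infinitely often, then the closed
half-space contains a recurrent direction. Otherwise, each point of its compact unit hemisphere has
a neighbourhood which almost surely contains only finitely many of the normalised positions. -/
theorem exists_mem_recurrentDirections_inner_nonpos (hmeas : ∀ i, Measurable (X i))
    (hindep : iIndepFun X P) (hident : ∀ i, IdentDistrib (X i) (X 0) P P)
    {v : EuclideanSpace ℝ (Fin d)}
    (hv : ∀ᵐ ω ∂P, ∃ᶠ n in atTop, inner ℝ (walk X n ω) v < 0) :
    ∃ u ∈ recurrentDirections P X, inner ℝ u v ≤ 0 := by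
  by_contra! hnone
  set K : Set (EuclideanSpace ℝ (Fin d)) := Metric.sphere 0 1 ∩ {u | inner ℝ u v ≤ 0} with hK
  have hKc : IsCompact K :=
    (isCompact_sphere 0 1).inter_right (isClosed_le (by fun_prop) continuous_const)
  have hfin : ∀ᵐ ω ∂P, ¬ ∃ᶠ n in atTop, hat (walk X n ω) ∈ K := by
    refine hKc.induction_on (p := fun s => ∀ᵐ ω ∂P, ¬ ∃ᶠ n in atTop, hat (walk X n ω) ∈ s)
      (by simp) (fun s t hst ht => ?_) (fun s t hs ht => ?_) fun u hu => ?_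
    · filter_upwards [ht] with ω hω h
      exact hω (h.mono fun n hn => hst hn)
    · filter_upwards [hs, ht] with ω h1 h2
      simp only [Set.mem_union, frequently_or_distrib, not_or]
      exact ⟨h1, h2⟩
    · have hnot : u ∉ recurrentDirections P X := fun h => (hnone u h).not_ge hu.2
      rw [mem_recurrentDirections_iff, not_and, not_forall] at hnot
      obtain ⟨k, hk⟩ := hnot (mem_sphere_zero_iff_norm.1 hu.1)
      have hball : MeasurableSet (hat ⁻¹' Metric.ball u (1 / ((k : ℝ) + 1))) :=
        measurable_hat Metric.isOpen_ball.measurableSet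
      refine ⟨Metric.ball u (1 / ((k : ℝ) + 1)),
        mem_nhdsWithin_of_mem_nhds (Metric.ball_mem_nhds u Nat.one_div_pos_of_nat),
        (ae_frequently_walk_or hmeas hindep hident hball).resolve_left fun h => hk ?_⟩
      filter_upwards [h] with ω hω
      exact hω.mono fun n hn => mem_ball_iff_norm.1 hn
  obtain ⟨ω, h1, h2⟩ := (hfin.and hv).exists
  refine h1 (h2.mono fun n hn => ⟨?_, ?_⟩)
  · have hne : walk X n ω ≠ 0 := by
      intro h0
      simp [h0] at hn
    exact mem_sphere_zero_iff_norm.2 (norm_hat_of_ne_zero hne)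
  · rw [Set.mem_ofPred_eq, inner_hat]
    exact mul_nonpos_of_nonneg_of_nonpos (by positivity) hn.le

/-- If every nonzero direction is unbounded, the origin is a convex combination of recurrent
directions: a hyperplane strictly separating it from the compact convex hull of these directions
would have all of them strictly on one side. -/
theorem zero_mem_convexHull_recurrentDirections (hd : 1 ≤ d) (hmeas : ∀ i, Measurable (X i))
    (hindep : iIndepFun X P) (hident : ∀ i, IdentDistrib (X i) (X 0) P P)
    (h : ∀ u : EuclideanSpace ℝ (Fin d), u ≠ 0 →
      ∀ᵐ ω ∂P, u ∉ barrierCone fun n => walk X n ω) :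
    (0 : EuclideanSpace ℝ (Fin d)) ∈ convexHull ℝ (recurrentDirections P X) := by
  have hhalf : ∀ v : EuclideanSpace ℝ (Fin d), v ≠ 0 →
      ∃ u ∈ recurrentDirections P X, inner ℝ u v ≤ 0 := fun v hv => by
    refine exists_mem_recurrentDirections_inner_nonpos hmeas hindep hident ?_
    filter_upwards [h (-v) (neg_ne_zero.2 hv)] with ω hω
    refine (notMem_barrierCone_iff.1 hω 0).mono fun n hn => ?_
    rwa [inner_neg_right, neg_pos] at hn
  by_contra h0
  obtain ⟨f, s, hs, hf⟩ := geometric_hahn_banach_point_closed (convex_convexHull ℝ _)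
    (isCompact_convexHull_of_isCompact isCompact_recurrentDirections).isClosed h0
  rw [map_zero] at hs
  have hfi : ∀ x, inner ℝ x ((InnerProductSpace.toDual ℝ _).symm f) = f x := fun x => by
    rw [real_inner_comm, InnerProductSpace.toDual_symm_apply]
  have : Nonempty (Fin d) := ⟨⟨0, hd⟩⟩
  obtain ⟨w, hw⟩ := exists_ne (0 : EuclideanSpace ℝ (Fin d))
  -- The separating functional is nonzero, because some recurrent direction exists.
  obtain ⟨u, hu, -⟩ := hhalf w hw
  have hf0 : (InnerProductSpace.toDual ℝ _).symm f ≠ 0 := fun hzero => by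
    have h1 := hf u (subset_convexHull ℝ _ hu)
    rw [← hfi, hzero, inner_zero_right] at h1
    exact lt_asymm hs h1
  obtain ⟨u', hu', hle⟩ := hhalf _ hf0
  rw [hfi] at hle
  exact absurd (hf u' (subset_convexHull ℝ _ hu')) (not_lt.2 (hle.trans hs.le))

/-- If the origin is interior to the convex hull of the recurrent directions, then every nonzero
direction is unbounded: some recurrent direction makes an acute angle with it, so that the walk has
positive projection infinitely often. -/
theorem ae_notMem_barrierCone_of_zero_mem_interior (hmeas : ∀ i, Measurable (X i))
    (hindep : iIndepFun X P) (hident : ∀ i, IdentDistrib (X i) (X 0) P P)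
    (hdim : GenuinelyDimensional (P.map (X 0)))
    (h0 : (0 : EuclideanSpace ℝ (Fin d)) ∈ interior (convexHull ℝ (recurrentDirections P X)))
    {u : EuclideanSpace ℝ (Fin d)} (hu : u ≠ 0) :
    ∀ᵐ ω ∂P, u ∉ barrierCone fun n => walk X n ω := by
  refine ae_notMem_barrierCone_of_frequently_pos hmeas hindep hident
    (hdim.not_ae_inner_eq_zero hu) ?_
  obtain ⟨w, hw, hwu⟩ : ∃ w ∈ recurrentDirections P X, 0 < inner ℝ w u := by
    by_contra! hle
    have hhull : ∀ x ∈ convexHull ℝ (recurrentDirections P X), inner ℝ x u ≤ 0 := fun x hx => by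
      refine convexHull_min (t := {y | inner ℝ y u ≤ 0}) hle ?_ hx
      simp_rw [real_inner_comm u]
      exact convex_halfSpace_le (innerₛₗ ℝ u).isLinear 0
    have ht : Tendsto (fun t : ℝ => t • u) (𝓝[>] 0) (𝓝 0) :=
      (Continuous.tendsto' (by fun_prop) 0 0 (zero_smul ℝ u)).mono_left nhdsWithin_le_nhds
    obtain ⟨t, htmem, htpos⟩ :=
      ((ht.eventually_mem (mem_interior_iff_mem_nhds.1 h0)).and self_mem_nhdsWithin).exists
    have h1 := hhull _ htmem
    rw [real_inner_smul_left] at h1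
    have h2 : 0 < inner ℝ u u := real_inner_self_pos.2 hu
    exact absurd h1 (not_le.2 (mul_pos htpos h2))
  obtain ⟨k, hk⟩ := exists_nat_one_div_lt (div_pos hwu (norm_pos_iff.2 hu))
  filter_upwards [(mem_recurrentDirections_iff.1 hw).2 k] with ω hω
  refine hω.mono fun n hn => ?_
  have hcs := abs_real_inner_le_norm (hat (walk X n ω) - w) u
  have hlt : ‖hat (walk X n ω) - w‖ * ‖u‖ < inner ℝ w u :=
    (lt_div_iff₀ (norm_pos_iff.2 hu)).1 (hn.trans hk)
  rw [inner_sub_left] at hcs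
  have hpos : 0 < inner ℝ (hat (walk X n ω)) u := by linarith [(abs_le.1 hcs).1]
  rw [inner_hat] at hpos
  by_contra! hle
  exact absurd hpos (not_lt.2 (mul_nonpos_of_nonneg_of_nonpos (by positivity) hle))

end IID

end Walk

end RandomWalkHull

theorem mainTheorem4 {d : ℕ} (hd : 1 ≤ d) {Ω : Type*} [MeasurableSpace Ω]
    (P : Measure Ω) [IsProbabilityMeasure P]
    (X : ℕ → Ω → EuclideanSpace ℝ (Fin d))
    (hmeas : ∀ i, Measurable (X i))
    (hindep : iIndepFun X P)
    (hident : ∀ i, IdentDistrib (X i) (X 0) P P)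
    (hdim : RandomWalkHull.GenuinelyDimensional (P.map (X 0))) :
    -- (i) implies (ii)
    ((0 : EuclideanSpace ℝ (Fin d)) ∈
        interior (convexHull ℝ (RandomWalkHull.recurrentDirections P X)) →
      ∀ᵐ ω ∂P, RandomWalkHull.innerRadiusInf X ω = ∞) ∧
    -- (ii) is equivalent to (iii)
    ((∀ᵐ ω ∂P, RandomWalkHull.innerRadiusInf X ω = ∞) ↔
      ∀ᵐ ω ∂P, RandomWalkHull.walkHullInf X ω = Set.univ) ∧
    -- (iii) is equivalent to (iv)
    ((∀ᵐ ω ∂P, RandomWalkHull.walkHullInf X ω = Set.univ) ↔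
      RandomWalkHull.oscillatingDirections P X =
        Metric.sphere (0 : EuclideanSpace ℝ (Fin d)) 1) ∧
    -- (iv) implies (v)
    (RandomWalkHull.oscillatingDirections P X =
        Metric.sphere (0 : EuclideanSpace ℝ (Fin d)) 1 →
      (0 : EuclideanSpace ℝ (Fin d)) ∈
        convexHull ℝ (RandomWalkHull.recurrentDirections P X)) := by
  have hiii : (∀ᵐ ω ∂P, RandomWalkHull.walkHullInf X ω = Set.univ) ↔
      ∀ u : EuclideanSpace ℝ (Fin d), u ≠ 0 →
        ∀ᵐ ω ∂P, u ∉ RandomWalkHull.barrierCone fun n => RandomWalkHull.walk X n ω := by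
    simp_rw [RandomWalkHull.walkHullInf_eq_univ_iff]
    refine ⟨fun h u hu => ?_,
      RandomWalkHull.ae_barrierCone_walk_subset_zero hmeas hindep hident⟩
    filter_upwards [h] with ω hω hmem
    exact hu (hω hmem)
  simp_rw [RandomWalkHull.innerRadiusInf_eq_top_iff,
    RandomWalkHull.oscillatingDirections_eq_sphere_iff]
  refine ⟨fun h0 => hiii.2 fun u hu => ?_, trivial, hiii, fun h => ?_⟩
  · exact RandomWalkHull.ae_notMem_barrierCone_of_zero_mem_interior hmeas hindep hident hdim h0 hu
  · exact RandomWalkHull.zero_mem_convexHull_recurrentDirections hd hmeas hindep hident h
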